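/- An ordered graph on $n$ vertices is a simple graph with vertex set $[n]=\{1,\dots,n\}$. An ordered graph $G$ on $[N]$ contains an ordered graph $H$ on $[n]$ as an ordered subgraph if there is a map $\phi:[n]\to[N]$ with $\phi(i)<\phi(j)$ for all $i<j$ such that $\phi(i)\phi(j)$ is an edge of $G$ whenever $ij$ is an edge of $H$. The interval chromatic number of an ordered graph is the minimum number of intervals into which its vertex set can be partitioned so that no two vertices in the same interval are adjacent. An ordered matching on $2n$ vertices is an ordered graph on $[2n]$ in which every vertex has exactly one neighbour. The edge density of a graph with $N\ge 2$ vertices and $e$ edges is $e/\binom N2$. Proposition. There are absolute constants $c, C>0$ such that for every integer $n\ge 1$ there exist an ordered matching $M$ on $2n$ vertices with interval chromatic number $2$, and an ordered graph $G$ on $N\ge 2^{c n^{1/12}}$ vertices with edge density at least $1-Cn^{-1/6}$, such that $G$ does not contain $M$ as an ordered subgraph. -/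

import Mathlib

/-- An ordered graph on `n` vertices: a simple graph whose vertex set is `Fin n` with its natural
order. -/
abbrev OrderedGraph (n : ℕ) : Type := SimpleGraph (Fin n)

namespace OrderedGraph

/-- The ordered graph `G` contains the ordered graph `H` (as an ordered subgraph): there is a
strictly increasing map of the vertices of `H` to those of `G` that sends edges to edges. -/
def Contains {N n : ℕ} (G : OrderedGraph N) (H : OrderedGraph n) : Prop :=
  ∃ φ : Fin n → Fin N, StrictMono φ ∧ ∀ i j : Fin n, H.Adj i j → G.Adj (φ i) (φ j)

/-- `H` is an ordered (perfect) matching: every vertex has exactly one neighbour. -/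
def IsMatching {n : ℕ} (H : OrderedGraph n) : Prop :=
  ∀ v : Fin n, ∃! w : Fin n, H.Adj v w

/-- `P` is a partition of the vertices of `H` into intervals so that no two vertices in the same
interval are adjacent. -/
def IsIntervalColoring {n : ℕ} (H : OrderedGraph n)
    (P : Finpartition (Finset.univ : Finset (Fin n))) : Prop :=
  ∀ I ∈ P.parts, (I : Set (Fin n)).OrdConnected ∧ ∀ u ∈ I, ∀ v ∈ I, ¬ H.Adj u v

/-- The partition into single vertices is admissible, so the minimum below is over a nonempty
set. -/
theorem exists_isIntervalColoring {n : ℕ} (H : OrderedGraph n) :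
    ∃ P : Finpartition (Finset.univ : Finset (Fin n)), IsIntervalColoring H P := by
  refine ⟨⊥, fun I hI => ?_⟩
  obtain ⟨a, -, rfl⟩ := Finpartition.mem_bot_iff.1 hI
  refine ⟨by simpa using Set.ordConnected_singleton, fun u hu v hv h => ?_⟩
  rw [Finset.mem_singleton] at hu hv
  subst hu hv
  exact H.loopless.irrefl _ h

/-- The interval chromatic number: the minimum number of intervals into which the vertex set may be
partitioned so that no two vertices in the same interval are adjacent. -/
noncomputable def intervalChromaticNumber {n : ℕ} (H : OrderedGraph n) : ℕ :=
  sInf {k : ℕ | ∃ P : Finpartition (Finset.univ : Finset (Fin n)),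
    IsIntervalColoring H P ∧ P.parts.card = k}

/-- The edge density of a graph on `N` vertices: the number of edges divided by `N choose 2`. -/
noncomputable def density {N : ℕ} (G : OrderedGraph N) : ℝ :=
  (G.edgeSet.ncard : ℝ) / (N.choose 2 : ℝ)

end OrderedGraph

/-!
With `l * l ≤ n`, the matching joins `s * l + t` on the left to `t * l + s` on the right
(`s, t < l`), and each remaining left vertex to the right vertex of the same index, so that
between the `s`-th block of `l` consecutive left vertices and the `t`-th block of `l` consecutive
right vertices there is exactly one edge. The host graph lives on `2 ^ k` vertices, and is obtained from the
complete graph by choosing a set `S` of pairs of dyadic intervals `(D, D')` and deleting all edges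
`xy`, `x < y`, with `x ∈ D`, `y ∈ D'` for some `(D, D') ∈ S`.

An embedding of the matching yields `l` disjoint intervals on the left and `l` disjoint intervals on
the right, with a surviving edge between any two of opposite sides. The smallest dyadic interval
around a given interval is split at its midpoint by that interval, so disjoint intervals have
distinct dyadic hulls (`dyadicHull_ne`). Hence there are `l` distinct dyadic intervals `D_s` and `l`
distinct dyadic intervals `D'_t` with no pair `(D_s, D'_t)` in `S` (`not_contains_dyadicGraph`).

If each pair is put into `S` independently with probability `1 / m`, a vertex pair is deleted with
probability at most `(k + 1) ^ 2 / m`, whereas a fixed `l × l` grid misses `S` with probability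
`(1 - 1 / m) ^ (l ^ 2)`, which beats the number `((k + 1) * 2 ^ k) ^ (2 * l)` of grids
(`exists_sparse_hitting`). The parameters `k = ⌊n ^ (1 / 12)⌋`, `l = k ^ 6` and `m = k ^ 4` give the
theorem as soon as `5 ≤ k`; for smaller `k` the density condition is void.
-/

open Finset

/-! ### Random sets of cells -/

theorem card_filter_forall_ne_zero {κ : Type*} [Fintype κ] [DecidableEq κ] {m : ℕ} [NeZero m]
    (T : Finset κ) :
    #{f : κ → Fin m | ∀ p ∈ T, f p ≠ 0} * m ^ #T = (m - 1) ^ #T * m ^ Fintype.card κ := by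
  have h : ({f : κ → Fin m | ∀ p ∈ T, f p ≠ 0} : Finset (κ → Fin m)) =
      Fintype.piFinset fun p => if p ∈ T then univ.erase 0 else univ := by
    ext f
    simp only [mem_filter_univ, Fintype.mem_piFinset]
    refine forall_congr' fun p => ?_
    split_ifs with hp <;> simp [hp]
  have hc : ∀ p, #(if p ∈ T then univ.erase 0 else (univ : Finset (Fin m))) =
      if p ∈ T then m - 1 else m := by
    intro p
    split_ifs <;> simp
  rw [h, Fintype.card_piFinset, prod_congr rfl fun p _ => hc p, prod_ite, prod_const, prod_const,
    filter_mem_eq_inter, univ_inter, mul_assoc, ← pow_add, add_comm]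
  congr 2
  have := card_filter_add_card_filter_not (s := (univ : Finset κ)) (· ∈ T)
  rw [filter_mem_eq_inter, univ_inter, card_univ] at this
  exact this

theorem card_filter_eq_zero {κ : Type*} [Fintype κ] [DecidableEq κ] {m : ℕ} [NeZero m] (p : κ) :
    #{f : κ → Fin m | f p = 0} * m = m ^ Fintype.card κ := by
  have h := card_filter_forall_ne_zero (m := m) {p}
  have h' := card_filter_add_card_filter_not (s := (univ : Finset (κ → Fin m))) (fun f => f p = 0)
  simp only [mem_singleton, forall_eq, card_singleton, pow_one] at h
  rw [card_univ, Fintype.card_fun, Fintype.card_fin] at h'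
  obtain ⟨j, rfl⟩ : ∃ j, m = j + 1 := ⟨m - 1, by have := NeZero.pos m; omega⟩
  simp only [Nat.add_sub_cancel, ne_eq] at h
  nlinarith

/-- First moment method for a random set of cells in `D × D`, each cell being chosen with
probability `1 / m` (a cell `p` is chosen by `f : D × D → Fin m` when `f p = 0`). If every `e ∈ E`
is spoilt by at most `d` cells, some choice hits every `l × l` grid while spoiling at most twice the
expected number of elements of `E`. -/
theorem exists_sparse_hitting {D ι : Type*} [Fintype D] [DecidableEq D] {m l d : ℕ} (hm : 0 < m)
    (h : 4 * (Fintype.card D ^ (2 * l) * (m - 1) ^ (l * l)) ≤ m ^ (l * l))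
    (E : Finset ι) (T : ι → Finset (D × D)) (hT : ∀ e, #(T e) ≤ d) (hE : 0 < d * #E) :
    ∃ S : Finset (D × D),
      (∀ A B : Fin l → D, A.Injective → B.Injective → ∃ s t, (A s, B t) ∈ S) ∧
      #{e ∈ E | ¬ Disjoint (T e) S} * m ≤ 2 * (d * #E) := by
  have : NeZero m := ⟨hm.ne'⟩
  set F : ℕ := m ^ Fintype.card (D × D) with hF
  have hF0 : 0 < F := pow_pos hm _
  let S : (D × D → Fin m) → Finset (D × D) := fun f => {p | f p = 0}
  let grids : Finset ((Fin l → D) × (Fin l → D)) := {g | g.1.Injective ∧ g.2.Injective}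
  let bad : (D × D → Fin m) → (Fin l → D) × (Fin l → D) → Prop :=
    fun f g => ∀ s t, f (g.1 s, g.2 t) ≠ 0
  classical
  have hgrids : #grids ≤ Fintype.card D ^ (2 * l) := by
    refine (card_le_univ _).trans_eq ?_
    simp [two_mul, pow_add]
  -- The expected number of grids that miss the random set is at most `1 / 4`.
  have hbad : 4 * ∑ f, #{g ∈ grids | bad f g} ≤ F := by
    have key : (∑ f, #{g ∈ grids | bad f g}) * m ^ (l * l) ≤
        Fintype.card D ^ (2 * l) * ((m - 1) ^ (l * l) * F) := by
      have hswap : ∑ f, #{g ∈ grids | bad f g} = ∑ g ∈ grids, #{f | bad f g} :=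
        sum_card_bipartiteAbove_eq_sum_card_bipartiteBelow bad
      rw [hswap, sum_mul]
      refine (sum_le_card_nsmul _ _ ((m - 1) ^ (l * l) * F) fun g hg => ?_).trans ?_
      · obtain ⟨hA, hB⟩ := (mem_filter_univ _).1 hg
        have hinj : Function.Injective (Prod.map g.1 g.2) := hA.prodMap hB
        have hcard : #(univ.image (Prod.map g.1 g.2)) = l * l := by
          rw [card_image_of_injective _ hinj]; simp
        have := card_filter_forall_ne_zero (m := m) (univ.image (Prod.map g.1 g.2))
        rw [hcard] at this
        rw [← this]
        refine Nat.mul_le_mul_right _ (card_le_card fun f hf => ?_)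
        simp only [mem_filter, mem_univ, true_and, bad] at hf
        simp only [mem_filter, mem_univ, true_and, mem_image]
        rintro _ ⟨⟨s, t⟩, rfl⟩
        exact hf s t
      · rw [smul_eq_mul]
        exact Nat.mul_le_mul_right _ hgrids
    refine Nat.le_of_mul_le_mul_right ?_ (pow_pos hm (l * l))
    calc _ = 4 * ((∑ f, #{g ∈ grids | bad f g}) * m ^ (l * l)) := by ring
      _ ≤ 4 * (Fintype.card D ^ (2 * l) * ((m - 1) ^ (l * l) * F)) := by gcongr
      _ = 4 * (Fintype.card D ^ (2 * l) * (m - 1) ^ (l * l)) * F := by ring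
      _ ≤ m ^ (l * l) * F := by gcongr
      _ = _ := by ring
  have hdel : (∑ f, #{e ∈ E | ¬ Disjoint (T e) (S f)}) * m ≤ d * #E * F := by
    have hswap : ∑ f, #{e ∈ E | ¬ Disjoint (T e) (S f)} =
        ∑ e ∈ E, #{f | ¬ Disjoint (T e) (S f)} :=
      sum_card_bipartiteAbove_eq_sum_card_bipartiteBelow fun f e => ¬ Disjoint (T e) (S f)
    rw [hswap, sum_mul]
    refine (sum_le_card_nsmul _ _ (d * F) fun e _ => ?_).trans_eq (by rw [smul_eq_mul]; ring)
    have hsub : ({f | ¬ Disjoint (T e) (S f)} : Finset (D × D → Fin m)) ⊆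
        (T e).biUnion fun p => {f : D × D → Fin m | f p = 0} := by
      intro f hf
      simp only [mem_filter, mem_univ, true_and, not_disjoint_iff, S] at hf
      simpa using hf
    calc _ ≤ (∑ p ∈ T e, #{f : D × D → Fin m | f p = 0}) * m :=
          Nat.mul_le_mul_right _ ((card_le_card hsub).trans card_biUnion_le)
      _ = #(T e) * F := by
          rw [sum_mul, sum_congr rfl fun p _ => card_filter_eq_zero p, sum_const, smul_eq_mul]
      _ ≤ d * F := Nat.mul_le_mul_right _ (hT e)
  by_contra! hcon
  have hall : ∀ f, 2 * (d * #E) ≤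
      2 * (d * #E) * #{g ∈ grids | bad f g} + #{e ∈ E | ¬ Disjoint (T e) (S f)} * m := by
    intro f
    rcases Nat.eq_zero_or_pos #{g ∈ grids | bad f g} with h0 | h0
    · refine le_add_left (hcon (S f) fun A B hA hB => ?_).le
      by_contra! hAB
      have : (A, B) ∈ ({g ∈ grids | bad f g} : Finset _) := by
        simp only [mem_filter, mem_univ, true_and, grids, bad, S] at hAB ⊢
        exact ⟨⟨hA, hB⟩, hAB⟩
      rw [card_eq_zero.1 h0] at this
      exact notMem_empty _ this
    · exact le_add_right (Nat.le_mul_of_pos_right _ h0)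
  have hsum := sum_le_sum fun f (_ : f ∈ univ) => hall f
  rw [sum_const, card_univ, Fintype.card_fun, Fintype.card_fin, smul_eq_mul, ← hF, sum_add_distrib,
    ← mul_sum, ← sum_mul] at hsum
  nlinarith [Nat.mul_le_mul_left (d * #E) hbad, Nat.mul_pos hE hF0]

/-! ### Dyadic intervals -/

/-- The dyadic interval of length `2 ^ j` in `{0, …, 2 ^ k - 1}` around `x`, encoded by `j` and by
the common quotient by `2 ^ j` of its elements. -/
def dyadicCell {k : ℕ} (j : Fin (k + 1)) (x : Fin (2 ^ k)) : Fin (k + 1) × Fin (2 ^ k) :=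
  (j, ⟨x / 2 ^ (j : ℕ), (Nat.div_le_self _ _).trans_lt x.2⟩)

/-- The smallest dyadic interval that contains both `a` and `b`. -/
noncomputable def dyadicHull {k : ℕ} (a b : Fin (2 ^ k)) : Fin (k + 1) × Fin (2 ^ k) :=
  have h : ∃ j, (a : ℕ) / 2 ^ j = b / 2 ^ j :=
    ⟨k, by rw [Nat.div_eq_of_lt a.2, Nat.div_eq_of_lt b.2]⟩
  dyadicCell ⟨Nat.find h, Nat.lt_succ_of_le <| Nat.find_min' h <| by
    rw [Nat.div_eq_of_lt a.2, Nat.div_eq_of_lt b.2]⟩ a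

theorem dyadicHull_spec {k : ℕ} (a b : Fin (2 ^ k)) :
    ∃ j : Fin (k + 1), dyadicHull a b = dyadicCell j a ∧
      (a : ℕ) / 2 ^ (j : ℕ) = b / 2 ^ (j : ℕ) ∧
      ∀ i < (j : ℕ), (a : ℕ) / 2 ^ i ≠ b / 2 ^ i :=
  have h : ∃ j, (a : ℕ) / 2 ^ j = b / 2 ^ j :=
    ⟨k, by rw [Nat.div_eq_of_lt a.2, Nat.div_eq_of_lt b.2]⟩
  ⟨_, rfl, Nat.find_spec h, fun _ hi => Nat.find_min h hi⟩

theorem exists_dyadicHull_eq {k : ℕ} (a b : Fin (2 ^ k)) :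
    ∃ j, ∀ x, a ≤ x → x ≤ b → dyadicHull a b = dyadicCell j x := by
  obtain ⟨j, hj, hab, -⟩ := dyadicHull_spec a b
  refine ⟨j, fun x hax hxb => hj.trans ?_⟩
  have h1 : (a : ℕ) / 2 ^ (j : ℕ) ≤ x / 2 ^ (j : ℕ) := Nat.div_le_div_right hax
  have h2 : (x : ℕ) / 2 ^ (j : ℕ) ≤ b / 2 ^ (j : ℕ) := Nat.div_le_div_right hxb
  simp only [dyadicCell, Prod.mk.injEq, Fin.mk.injEq, true_and]
  omega

/-- Disjoint intervals have distinct dyadic hulls: each of them contains both middle points of its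
own hull, or is a single point. -/
theorem dyadicHull_ne {k : ℕ} {a b a' b' : Fin (2 ^ k)} (h₁ : a ≤ b) (h₂ : b < a') (h₃ : a' ≤ b') :
    dyadicHull a b ≠ dyadicHull a' b' := by
  obtain ⟨j, hj, hab, hmin⟩ := dyadicHull_spec a b
  obtain ⟨j', hj', hab', hmin'⟩ := dyadicHull_spec a' b'
  rw [hj, hj']
  intro heq
  simp only [dyadicCell, Prod.mk.injEq, Fin.mk.injEq] at heq
  obtain ⟨rfl, heq⟩ := heq
  rcases hi : (j : ℕ) with _ | i
  · simp only [hi, pow_zero, Nat.div_one] at heq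
    exact absurd (h₁.trans_lt h₂) (by rw [Fin.ext heq]; exact lt_irrefl _)
  · have e1 := hmin i (by omega)
    have e2 := hmin' i (by omega)
    rw [hi] at hab hab' heq
    simp only [pow_succ, ← Nat.div_div_eq_div_mul] at hab hab' heq
    have m1 : (a : ℕ) / 2 ^ i ≤ b / 2 ^ i := Nat.div_le_div_right h₁
    have m2 : (b : ℕ) / 2 ^ i ≤ a' / 2 ^ i := Nat.div_le_div_right h₂.le
    have m3 : (a' : ℕ) / 2 ^ i ≤ b' / 2 ^ i := Nat.div_le_div_right h₃
    omega

/-! ### The host graph -/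

/-- The pairs of dyadic intervals around the smaller and the larger end of an edge. -/
def dyadicCells {k : ℕ} (e : Sym2 (Fin (2 ^ k))) :
    Finset ((Fin (k + 1) × Fin (2 ^ k)) × (Fin (k + 1) × Fin (2 ^ k))) :=
  univ.image fun ij : Fin (k + 1) × Fin (k + 1) => (dyadicCell ij.1 e.inf, dyadicCell ij.2 e.sup)

theorem card_dyadicCells_le {k : ℕ} (e : Sym2 (Fin (2 ^ k))) :
    #(dyadicCells e) ≤ (k + 1) ^ 2 :=
  card_image_le.trans_eq (by simp [sq])

/-- The complete graph on `2 ^ k` vertices, with the edges deleted that go from `D` to `D'` for some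
pair of dyadic intervals `(D, D') ∈ S`, the smaller end lying in `D`. -/
def dyadicGraph {k : ℕ} (S : Finset ((Fin (k + 1) × Fin (2 ^ k)) × (Fin (k + 1) × Fin (2 ^ k)))) :
    OrderedGraph (2 ^ k) where
  Adj x y := x ≠ y ∧ Disjoint (dyadicCells s(x, y)) S
  symm := ⟨fun x y h => ⟨h.1.symm, by rw [Sym2.eq_swap]; exact h.2⟩⟩
  loopless := ⟨fun _ h => h.1 rfl⟩

theorem le_ncard_edgeSet_dyadicGraph {k : ℕ}
    (S : Finset ((Fin (k + 1) × Fin (2 ^ k)) × (Fin (k + 1) × Fin (2 ^ k)))) :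
    #{e ∈ (⊤ : SimpleGraph (Fin (2 ^ k))).edgeFinset | Disjoint (dyadicCells e) S} ≤
      (dyadicGraph S).edgeSet.ncard := by
  rw [← Set.ncard_coe_finset]
  refine Set.ncard_le_ncard (fun e he => ?_) (Set.toFinite _)
  induction e with
  | _ x y =>
    simp only [coe_filter, Set.mem_ofPred_eq, SimpleGraph.mem_edgeFinset, SimpleGraph.mem_edgeSet,
      SimpleGraph.top_adj] at he
    exact he

theorem notMem_of_dyadicGraph_adj {k : ℕ}
    {S : Finset ((Fin (k + 1) × Fin (2 ^ k)) × (Fin (k + 1) × Fin (2 ^ k)))} {x y : Fin (2 ^ k)}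
    (hxy : x ≤ y) (h : (dyadicGraph S).Adj x y) (i j : Fin (k + 1)) :
    (dyadicCell i x, dyadicCell j y) ∉ S := by
  refine disjoint_left.1 h.2 (mem_image.2 ⟨(i, j), mem_univ _, ?_⟩)
  simp [hxy]

/-! ### The matching -/

/-- The involution of `ℕ` that exchanges the two base-`l` digits of the numbers below `l * l`, and
fixes all other numbers. -/
def digitSwap (l i : ℕ) : ℕ := if i < l * l then i % l * l + i / l else i

theorem digitSwap_apply {l s t : ℕ} (hs : s < l) (ht : t < l) :
    digitSwap l (s * l + t) = t * l + s := by
  have h : s * l + t < l * l := by nlinarith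
  have h1 : (s * l + t) % l = t := by rw [Nat.mul_add_mod', Nat.mod_eq_of_lt ht]
  have h2 : (s * l + t) / l = s := by
    rw [add_comm, Nat.add_mul_div_right _ _ (by omega), Nat.div_eq_of_lt ht, zero_add]
  rw [digitSwap, if_pos h, h1, h2]

theorem digitSwap_digitSwap (l i : ℕ) : digitSwap l (digitSwap l i) = i := by
  by_cases h : i < l * l
  · have hl : 0 < l := Nat.pos_of_ne_zero (by rintro rfl; simp at h)
    have h1 : i % l < l := Nat.mod_lt _ hl
    have h2 : i / l < l := Nat.div_lt_of_lt_mul h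
    have h3 : i / l * l + i % l = i := Nat.div_add_mod' i l
    rw [← h3, digitSwap_apply h2 h1, digitSwap_apply h1 h2]
  · simp [digitSwap, h]

theorem digitSwap_lt {l n i : ℕ} (hl : l * l ≤ n) (hi : i < n) : digitSwap l i < n := by
  rw [digitSwap]
  split_ifs with h
  · have h0 : 0 < l := Nat.pos_of_ne_zero (by rintro rfl; simp at h)
    have h1 : i % l < l := Nat.mod_lt _ h0
    have h2 : i / l < l := Nat.div_lt_of_lt_mul h
    nlinarith
  · exact hi

/-- The partner of a vertex in `gridMatching`: `i < n` and `n + digitSwap l i` are partners. -/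
def gridPartner {n l : ℕ} (hl : l * l ≤ n) (v : Fin (2 * n)) : Fin (2 * n) :=
  if h : (v : ℕ) < n then ⟨n + digitSwap l v, by have := digitSwap_lt hl h; omega⟩
  else ⟨digitSwap l (v - n), by
    have := digitSwap_lt (i := v - n) hl (by have := v.2; omega); omega⟩

theorem gridPartner_of_lt {n l : ℕ} (hl : l * l ≤ n) {v : Fin (2 * n)} (h : (v : ℕ) < n) :
    (gridPartner hl v : ℕ) = n + digitSwap l v := by
  simp [gridPartner, h]

theorem gridPartner_of_le {n l : ℕ} (hl : l * l ≤ n) {v : Fin (2 * n)} (h : n ≤ (v : ℕ)) :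
    (gridPartner hl v : ℕ) = digitSwap l (v - n) := by
  simp [gridPartner, h.not_gt]

theorem gridPartner_lt_iff {n l : ℕ} (hl : l * l ≤ n) (v : Fin (2 * n)) :
    (gridPartner hl v : ℕ) < n ↔ n ≤ (v : ℕ) := by
  rcases lt_or_ge (v : ℕ) n with h | h
  · rw [gridPartner_of_lt hl h]; omega
  · rw [gridPartner_of_le hl h]
    have := digitSwap_lt (i := v - n) hl (by have := v.2; omega)
    omega

theorem gridPartner_involutive {n l : ℕ} (hl : l * l ≤ n) :
    Function.Involutive (gridPartner hl) := by
  intro v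
  refine Fin.ext ?_
  rcases lt_or_ge (v : ℕ) n with h | h
  · have h' := gridPartner_of_lt hl h
    rw [gridPartner_of_le hl (by omega), h', Nat.add_sub_cancel_left, digitSwap_digitSwap]
  · rw [gridPartner_of_lt hl ((gridPartner_lt_iff hl v).2 h), gridPartner_of_le hl h,
      digitSwap_digitSwap]
    omega

/-- The ordered matching on `2 * n` vertices given by the permutation `digitSwap l`. It has exactly
one edge between the block of left vertices `[s * l, (s + 1) * l)` and the block of right vertices
`n + [t * l, (t + 1) * l)`, for all `s, t < l`. -/
def gridMatching {n l : ℕ} (hl : l * l ≤ n) : OrderedGraph (2 * n) where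
  Adj u v := gridPartner hl u = v
  symm := ⟨fun u v h => by rw [← h]; exact gridPartner_involutive hl u⟩
  loopless := ⟨fun v h => by
    have := gridPartner_lt_iff hl v
    rw [h] at this
    omega⟩

theorem gridMatching_isMatching {n l : ℕ} (hl : l * l ≤ n) :
    OrderedGraph.IsMatching (gridMatching hl) :=
  fun v => ⟨gridPartner hl v, rfl, fun _ h => Eq.symm h⟩

theorem intervalChromaticNumber_gridMatching {n l : ℕ} (hl : l * l ≤ n) (hn : 1 ≤ n) :
    OrderedGraph.intervalChromaticNumber (gridMatching hl) = 2 := by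
  have v₀ : Fin (2 * n) := ⟨0, by omega⟩
  refine le_antisymm (Nat.sInf_le ?_) (le_csInf ?_ ?_)
  · let L : Finset (Fin (2 * n)) := {v | (v : ℕ) < n}
    let R : Finset (Fin (2 * n)) := {v | n ≤ (v : ℕ)}
    have hL : L ≠ ⊥ := ne_empty_of_mem (a := ⟨0, by omega⟩) (by simp [L]; omega)
    have hR : R ≠ ⊥ := ne_empty_of_mem (a := ⟨n, by omega⟩) (by simp [R])
    have hd : Disjoint L R := disjoint_left.2 fun v h h' => by
      simp only [L, R, mem_filter_univ] at h h'; omega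
    have hu : L ⊔ R = univ := by
      ext v
      simp only [L, R, sup_eq_union, mem_union, mem_filter_univ, mem_univ, iff_true]
      omega
    refine ⟨(Finpartition.indiscrete hL).extend hR hd hu, fun I hI => ?_, ?_⟩
    · have : I = R ∨ I = L := by simpa using hI
      rcases this with rfl | rfl
      · refine ⟨⟨fun x hx y hy z hz => ?_⟩, fun u hu v hv h => ?_⟩
        · simp only [R, coe_filter, mem_univ, true_and, Set.mem_ofPred_eq] at hx ⊢
          exact hx.trans hz.1
        · simp only [R, mem_filter_univ] at hu hv
          have := (gridPartner_lt_iff hl u).2 hu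
          rw [show gridPartner hl u = v from h] at this
          omega
      · refine ⟨⟨fun x hx y hy z hz => ?_⟩, fun u hu v hv h => ?_⟩
        · simp only [L, coe_filter, mem_univ, true_and, Set.mem_ofPred_eq] at hy ⊢
          exact lt_of_le_of_lt hz.2 hy
        · simp only [L, mem_filter_univ] at hu hv
          have := (gridPartner_lt_iff hl u).1 (by rw [show gridPartner hl u = v from h]; exact hv)
          omega
    · rw [Finpartition.card_extend]
      simp
  · obtain ⟨P, hP⟩ := OrderedGraph.exists_isIntervalColoring (gridMatching hl)
    exact ⟨_, P, hP, rfl⟩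
  · rintro _ ⟨P, hP, rfl⟩
    by_contra! hlt
    obtain ⟨I, hI, hvI⟩ := P.exists_mem (mem_univ v₀)
    obtain ⟨J, hJ, hvJ⟩ := P.exists_mem (mem_univ (gridPartner hl v₀))
    obtain rfl := card_le_one.1 (Nat.lt_succ_iff.1 hlt) I hI J hJ
    exact (hP I hI).2 _ hvI _ hvJ rfl

/-- The dyadic hulls of `l` consecutive blocks, each of `l` consecutive values of an increasing
sequence, are distinct. -/
theorem dyadicHull_blocks_injective {k n l a : ℕ} (φ : Fin n → Fin (2 ^ k))
    (hφ : StrictMono φ) (p q : Fin l → Fin n) (hp : ∀ s, (p s : ℕ) = a + s * l)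
    (hq : ∀ s, (q s : ℕ) = a + s * l + (l - 1)) :
    Function.Injective fun s => dyadicHull (φ (p s)) (φ (q s)) := by
  have hle : ∀ s, φ (p s) ≤ φ (q s) := fun s =>
    hφ.monotone (Fin.le_def.2 (by rw [hp, hq]; omega))
  have hlt : ∀ s t, s < t → φ (q s) < φ (p t) := fun s t hst => hφ <| Fin.lt_def.2 <| by
    have h1 : (s : ℕ) + 1 ≤ t := hst
    have h2 := Nat.mul_le_mul_right l h1
    have := t.2
    rw [hp, hq]
    rw [add_mul] at h2
    omega
  intro s t hst
  rcases lt_trichotomy s t with hlt' | heq | hlt'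
  · exact absurd hst (dyadicHull_ne (hle s) (hlt s t hlt') (hle t))
  · exact heq
  · exact absurd hst.symm (dyadicHull_ne (hle t) (hlt t s hlt') (hle s))

theorem not_contains_dyadicGraph {k n l : ℕ} (hl : l * l ≤ n)
    {S : Finset ((Fin (k + 1) × Fin (2 ^ k)) × (Fin (k + 1) × Fin (2 ^ k)))}
    (hS : ∀ A B : Fin l → Fin (k + 1) × Fin (2 ^ k), A.Injective → B.Injective →
      ∃ s t, (A s, B t) ∈ S) :
    ¬ OrderedGraph.Contains (dyadicGraph S) (gridMatching hl) := by
  rintro ⟨φ, hφ, hadj⟩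
  have hb : ∀ s t : Fin l, (s : ℕ) * l + t < l * l := fun s t => by nlinarith [s.2, t.2]
  have hb' : ∀ s : Fin l, (s : ℕ) * l + (l - 1) < l * l := fun s =>
    hb s ⟨l - 1, by have := s.2; omega⟩
  let p : Fin l → Fin (2 * n) := fun s => ⟨0 + s * l, by have := hb' s; omega⟩
  let q : Fin l → Fin (2 * n) := fun s => ⟨0 + s * l + (l - 1), by have := hb' s; omega⟩
  let p' : Fin l → Fin (2 * n) := fun s => ⟨n + s * l, by have := hb' s; omega⟩
  let q' : Fin l → Fin (2 * n) := fun s => ⟨n + s * l + (l - 1), by have := hb' s; omega⟩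
  obtain ⟨s, t, hst⟩ := hS _ _
    (dyadicHull_blocks_injective φ hφ p q (fun _ => rfl) fun _ => rfl)
    (dyadicHull_blocks_injective φ hφ p' q' (fun _ => rfl) fun _ => rfl)
  let x : Fin (2 * n) := ⟨s * l + t, by have := hb s t; omega⟩
  let y : Fin (2 * n) := ⟨n + (t * l + s), by have := hb t s; omega⟩
  have hxn : (x : ℕ) < n := (hb s t).trans_le hl
  have hxy : gridPartner hl x = y := Fin.ext <| by
    rw [gridPartner_of_lt hl hxn, digitSwap_apply s.2 t.2]
  have hle : φ x ≤ φ y := hφ.monotone (Fin.le_def.2 (hxn.le.trans (Nat.le_add_right _ _)))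
  obtain ⟨i, hi⟩ := exists_dyadicHull_eq (φ (p s)) (φ (q s))
  obtain ⟨j, hj⟩ := exists_dyadicHull_eq (φ (p' t)) (φ (q' t))
  have hs := s.2
  have ht := t.2
  rw [hi (φ x) (hφ.monotone (Fin.le_def.2 (by simp only [p, x]; omega)))
      (hφ.monotone (Fin.le_def.2 (by simp only [q, x]; omega))),
    hj (φ y) (hφ.monotone (Fin.le_def.2 (by simp only [p', y]; omega)))
      (hφ.monotone (Fin.le_def.2 (by simp only [q', y]; omega)))] at hst
  exact notMem_of_dyadicGraph_adj hle (hadj x y hxy) i j hst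

/-! ### Choice of parameters -/

theorem two_mul_pred_pow_le {m : ℕ} (hm : 0 < m) : 2 * (m - 1) ^ m ≤ m ^ m := by
  obtain ⟨j, rfl⟩ : ∃ j, m = j + 1 := ⟨m - 1, by omega⟩
  rw [Nat.add_sub_cancel]
  -- The first two terms of the binomial expansion of `(j + 1) ^ (i + 1)`.
  have h : ∀ i, j ^ (i + 1) + (i + 1) * j ^ i ≤ (j + 1) ^ (i + 1) := by
    intro i
    induction i with
    | zero => simp
    | succ i ih =>
      have := Nat.mul_le_mul_right (j + 1) ih
      rw [pow_succ (j + 1) (i + 1)]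
      refine le_trans ?_ this
      rw [pow_succ j (i + 1), pow_succ j i]
      nlinarith [Nat.zero_le (i * j ^ i), Nat.zero_le (j ^ i)]
  have hj := h j
  have hp : j ^ (j + 1) = j * j ^ j := by ring
  nlinarith [Nat.zero_le (j ^ j)]

/-- The union bound over all grids, with cell probability `1 / k ^ 4` and grid size `k ^ 6`: there
are at most `2 ^ (4 * k ^ 7)` grids, and each misses the random set with probability at most
`2 ^ (-k ^ 8)`. -/
theorem grid_count_le {k : ℕ} (hk : 5 ≤ k) :
    4 * (((k + 1) * 2 ^ k) ^ (2 * k ^ 6) * (k ^ 4 - 1) ^ (k ^ 6 * k ^ 6)) ≤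
      (k ^ 4) ^ (k ^ 6 * k ^ 6) := by
  have h1 : (k + 1) * 2 ^ k ≤ 2 ^ (2 * k) := by
    rw [two_mul, pow_add]
    exact Nat.mul_le_mul_right _ Nat.lt_two_pow_self
  have h2 : 2 ^ k ^ 8 * (k ^ 4 - 1) ^ (k ^ 6 * k ^ 6) ≤ (k ^ 4) ^ (k ^ 6 * k ^ 6) := by
    have e : k ^ 6 * k ^ 6 = k ^ 4 * k ^ 8 := by ring
    rw [e, pow_mul, pow_mul, ← mul_pow]
    exact Nat.pow_le_pow_left (two_mul_pred_pow_le (by positivity)) _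
  have h3 : 2 + 4 * k ^ 7 ≤ k ^ 8 := by
    have : 5 ^ 7 ≤ k ^ 7 := Nat.pow_le_pow_left hk 7
    have e : k ^ 8 = k * k ^ 7 := by ring
    nlinarith
  calc _ ≤ 4 * ((2 ^ (2 * k)) ^ (2 * k ^ 6) * (k ^ 4 - 1) ^ (k ^ 6 * k ^ 6)) := by gcongr
    _ = 2 ^ (2 + 4 * k ^ 7) * (k ^ 4 - 1) ^ (k ^ 6 * k ^ 6) := by
        rw [← pow_mul, show 2 * k * (2 * k ^ 6) = 4 * k ^ 7 by ring, pow_add]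
        ring
    _ ≤ 2 ^ k ^ 8 * (k ^ 4 - 1) ^ (k ^ 6 * k ^ 6) := by gcongr; norm_num
    _ ≤ _ := h2

theorem exists_dense_not_contains {k n : ℕ} (hk : 5 ≤ k) (hl : k ^ 6 * k ^ 6 ≤ n) :
    ∃ G : OrderedGraph (2 ^ k), 1 - 32 / ((k : ℝ) + 1) ^ 2 ≤ OrderedGraph.density G ∧
      ¬ OrderedGraph.Contains G (gridMatching hl) := by
  have hcard : #(⊤ : SimpleGraph (Fin (2 ^ k))).edgeFinset = (2 ^ k).choose 2 := by
    rw [SimpleGraph.card_edgeFinset_top_eq_card_choose_two, Fintype.card_fin]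
  have hpos : 0 < (2 ^ k).choose 2 :=
    Nat.choose_pos ((pow_one 2).symm.le.trans (Nat.pow_le_pow_right two_pos (by omega)))
  obtain ⟨S, hS, hdel⟩ := exists_sparse_hitting (D := Fin (k + 1) × Fin (2 ^ k))
    (m := k ^ 4) (l := k ^ 6) (d := (k + 1) ^ 2) (by positivity)
    (by simpa using grid_count_le hk)
    (⊤ : SimpleGraph (Fin (2 ^ k))).edgeFinset dyadicCells card_dyadicCells_le
    (by rw [hcard]; positivity)
  refine ⟨dyadicGraph S, ?_, not_contains_dyadicGraph hl hS⟩
  have hedge := le_ncard_edgeSet_dyadicGraph S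
  have hsplit := card_filter_add_card_filter_not
    (s := (⊤ : SimpleGraph (Fin (2 ^ k))).edgeFinset) (fun e => Disjoint (dyadicCells e) S)
  rw [hcard] at hsplit hdel
  set d := #{e ∈ (⊤ : SimpleGraph (Fin (2 ^ k))).edgeFinset | ¬ Disjoint (dyadicCells e) S}
  set c := (2 ^ k).choose 2
  have hcR : (0 : ℝ) < c := by exact_mod_cast hpos
  have hkR : (5 : ℝ) ≤ k := by exact_mod_cast hk
  have hR : (c : ℝ) ≤ (dyadicGraph S).edgeSet.ncard + d := by
    exact_mod_cast hsplit.symm.le.trans (Nat.add_le_add_right hedge d)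
  have hdR : (d : ℝ) * (k : ℝ) ^ 4 ≤ 2 * (((k : ℝ) + 1) ^ 2 * c) := by exact_mod_cast hdel
  rw [OrderedGraph.density, le_div_iff₀ hcR]
  have hd : (d : ℝ) ≤ 32 / ((k : ℝ) + 1) ^ 2 * c := by
    rw [div_mul_eq_mul_div, le_div_iff₀ (by positivity)]
    have h16 : ((k : ℝ) + 1) ^ 4 ≤ (2 * k) ^ 4 := by gcongr; linarith
    have hk4 : (0 : ℝ) < (k : ℝ) ^ 4 := by positivity
    refine le_of_mul_le_mul_right ?_ hk4
    calc (d : ℝ) * ((k : ℝ) + 1) ^ 2 * (k : ℝ) ^ 4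
        = (d : ℝ) * (k : ℝ) ^ 4 * ((k : ℝ) + 1) ^ 2 := by ring
      _ ≤ 2 * (((k : ℝ) + 1) ^ 2 * c) * ((k : ℝ) + 1) ^ 2 := by gcongr
      _ = 2 * c * ((k : ℝ) + 1) ^ 4 := by ring
      _ ≤ 2 * c * (2 * k) ^ 4 := by gcongr
      _ = _ := by ring
  linarith

theorem mainTheorem11 :
    ∃ c C : ℝ, 0 < c ∧ 0 < C ∧ ∀ n : ℕ, 1 ≤ n →
      ∃ M : OrderedGraph (2 * n),
        OrderedGraph.IsMatching M ∧ OrderedGraph.intervalChromaticNumber M = 2 ∧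
        ∃ (N : ℕ) (G : OrderedGraph N),
          (2 : ℝ) ^ (c * (n : ℝ) ^ (1 / 12 : ℝ)) ≤ (N : ℝ) ∧
          1 - C * (n : ℝ) ^ (-(1 / 6) : ℝ) ≤ OrderedGraph.density G ∧
          ¬ OrderedGraph.Contains G M := by
  refine ⟨1 / 2, 32, by norm_num, by norm_num, fun n hn => ?_⟩
  have hnR : (1 : ℝ) ≤ n := by exact_mod_cast hn
  set x : ℝ := (n : ℝ) ^ (1 / 12 : ℝ) with hx
  have hx1 : 1 ≤ x := Real.one_le_rpow hnR (by norm_num)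
  have hxn : x ^ 12 = n := by
    rw [hx, ← Real.rpow_natCast, ← Real.rpow_mul (by positivity)]
    norm_num
  have hx2 : (n : ℝ) ^ (-(1 / 6) : ℝ) = 1 / x ^ 2 := by
    rw [hx, ← Real.rpow_natCast, ← Real.rpow_mul (by positivity), one_div (_ ^ _),
      ← Real.rpow_neg (by positivity)]
    norm_num
  obtain ⟨k, hk1, hkx, hxk⟩ : ∃ k : ℕ, 1 ≤ k ∧ (k : ℝ) ≤ x ∧ x < k + 1 :=
    ⟨⌊x⌋₊, Nat.le_floor (by exact_mod_cast hx1), Nat.floor_le (by linarith), Nat.lt_floor_add_one x⟩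
  have hl : k ^ 6 * k ^ 6 ≤ n := by
    have : (k : ℝ) ^ 12 ≤ n := hxn ▸ pow_le_pow_left₀ (by positivity) hkx 12
    rw [← pow_add]
    exact_mod_cast this
  have hN : (2 : ℝ) ^ (1 / 2 * x) ≤ ((2 ^ k : ℕ) : ℝ) := by
    rw [Nat.cast_pow, ← Real.rpow_natCast, Nat.cast_ofNat]
    have : (1 : ℝ) ≤ k := by exact_mod_cast hk1
    exact Real.rpow_le_rpow_of_exponent_le (by norm_num) (by linarith)
  refine ⟨gridMatching hl, gridMatching_isMatching hl, intervalChromaticNumber_gridMatching hl hn,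
    2 ^ k, ?_⟩
  rw [hx2]
  rcases le_or_gt 5 k with hk | hk
  · obtain ⟨G, hG, hM⟩ := exists_dense_not_contains hk hl
    refine ⟨G, hN, le_trans ?_ hG, hM⟩
    rw [mul_one_div]
    gcongr
  -- Here `1 - 32 / x ^ 2` is negative, so the edgeless graph is dense enough.
  · refine ⟨⊥, hN, ?_, ?_⟩
    · have h5 : x ≤ 5 := by
        have : (k : ℝ) + 1 ≤ 5 := by exact_mod_cast hk
        linarith
      have : 1 ≤ 32 * (1 / x ^ 2) := by
        rw [mul_one_div, one_le_div (by positivity)]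
        nlinarith
      refine le_trans (by linarith) (div_nonneg (Nat.cast_nonneg _) (Nat.cast_nonneg _))
    · rintro ⟨φ, -, h⟩
      exact h ⟨0, by omega⟩ (gridPartner hl ⟨0, by omega⟩) rfl
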